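/- Let $\Gamma$ be a simply connected quad-graph, that is, a cell decomposition of an oriented surface (possibly with boundary, finite or infinite) all of whose faces are quadrilaterals, such that $\Gamma$ with its faces filled in is connected and every closed edge path is contractible. A characteristic $C$ of $\Gamma$ is a class of edges for the equivalence relation generated by passing from an edge of a face to the opposite edge of that face (the edges crossed by one strip of quadrilaterals). Each characteristic carries an arbitrary parameter $\alpha_C\in\mathbb C$, and $\alpha_{ij}$ denotes the parameter of the characteristic containing the edge $(i,j)$. A solution of the dKdV equation on $\Gamma$ is a complex-valued function $v$ on the vertices such that $(v_{12}-v)(v_1-v_2)=\alpha_1-\alpha_2$ on every face with consecutive corners $v,v_1,v_{12},v_2$, where $\alpha_1,\alpha_2$ are the parameters of the edges $(v,v_1)$ and $(v,v_2)$. For an edge $(i,j)$ put $$L_{j,i}(\lambda)=\begin{pmatrix}-v_i & v_iv_j+\alpha_{ij}-\lambda\\ -1& v_j\end{pmatrix},$$ and for a path $P=(i_0,i_1,\dots,i_n)$ put $\prod_P L_{ji}=L_{i_n,i_{n-1}}\cdots L_{i_2,i_1}L_{i_1,i_0}$. Let $\mathrm{ind}(C,P)$ be the number of steps of $P$ along edges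 belonging to $C$. 1) For every solution $v$ and every closed path $P$, all the numbers $\mathrm{ind}(C,P)$ are even and $$\prod_P L_{ji}(\lambda)=\prod_C(\lambda-\alpha_C)^{\frac12\mathrm{ind}(C,P)}\,I\qquad\text{for all }\lambda\in\mathbb C .$$ 2) Let $P_1$ be a path with $\mathrm{ind}(C,P_1)\le 1$ for every characteristic $C$. There is a nonzero polynomial $g$ in the values of the field at the vertices of $P_1$, depending only on $\Gamma$, the parameters and $P_1$ and not vanishing on some solution, such that the following holds. Let $v$ be a solution which is generic, that is, $g(v|_{P_1})\ne0$; if the characteristics crossing $P_1$ have pairwise distinct parameters, let $v$ be any solution. Let $P_2$ be any path with the same starting point $i_0$ and the same end point as $P_1$ and with $\mathrm{ind}(C,P_2)=\mathrm{ind}(C,P_1)$ for every $C$. Then the values of $v$ on $P_2$ are uniquely recovered from its values on $P_1$: any solution that coincides with $v$ on $P_1$ coincides with it on $P_2$. Moreover the recovery is a refactorization: $\prod_{P_2}L_{ji}(\lambda)=\prod_{P_1}L_{ji}(\lambda)$ for all $\lambda$, and $v|_{P_2}$ is the only field on $P_2$ with the value $v_{i_0}$ at $i_0$ whose product $\prod_{P_2}L_{ji}(\lambda)$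 equals the product $\prod_{P_1}L_{ji}(\lambda)$ formed with $v$, for all $\lambda$. -/

import Mathlib

universe u₁ u₂ u₃

/-- A quad-graph with vertex set `V`, set of directed edges `D` and set of quadrilateral faces `F`.
Each undirected edge is a pair `{d, rev d}`.  The boundary of a face is traversed in the positive
sense as a closed chain of four directed edges, so each directed edge has at most one face on its
left (`bdry_injective`): this is the usual combinatorial description of the cell decomposition of
an oriented surface, possibly with boundary.  Multiple edges are allowed. -/
structure QuadGraph (V : Type u₁) (D : Type u₂) (F : Type u₃) where
  src : D → V
  rev : D → D
  rev_rev : ∀ d, rev (rev d) = d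
  rev_ne : ∀ d, rev d ≠ d
  bdry : F → Fin 4 → D
  bdry_chain : ∀ f i, src (rev (bdry f i)) = src (bdry f (i + 1))
  bdry_injective : Function.Injective fun p : F × Fin 4 => bdry p.1 p.2

namespace QuadGraph

variable {V : Type u₁} {D : Type u₂} {F : Type u₃} (G : QuadGraph V D F)

/-- The end point of a directed edge. -/
def tgt (d : D) : V := G.src (G.rev d)

/-- The list of directed edges `p` is a path (self-intersections allowed) from `a` to `b`. -/
def IsPath : V → List D → V → Prop
  | a, [], b => a = b
  | a, d :: p, b => G.src d = a ∧ IsPath (G.tgt d) p b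

/-- The vertices visited by a path that starts at `a`. -/
def support (a : V) (p : List D) : List V := a :: p.map G.tgt

/-- Elementary homotopies of paths starting at `a`: insertion of a backtrack, and insertion of the
boundary of a face (read from any of its corners). -/
inductive Step (a : V) : List D → List D → Prop
  | backtrack (p q : List D) (d : D) (hp : G.IsPath a p (G.src d)) :
      Step a (p ++ q) (p ++ d :: G.rev d :: q)
  | face (p q : List D) (f : F) (i : Fin 4) (hp : G.IsPath a p (G.src (G.bdry f i))) :
      Step a (p ++ q)
        (p ++ G.bdry f i :: G.bdry f (i + 1) :: G.bdry f (i + 2) :: G.bdry f (i + 3) :: q)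

/-- The quad-graph (with its faces filled in) is connected and each closed path in it is
contractible. -/
def SimplyConnected : Prop :=
  (∀ a b : V, ∃ p : List D, G.IsPath a p b) ∧
    ∀ (a : V) (p : List D), G.IsPath a p a → Relation.EqvGen (G.Step a) p []

/-- Two directed edges are related if they are the two orientations of one edge, or opposite edges
of a face. -/
inductive StripAdj : D → D → Prop
  | rev (d : D) : StripAdj d (G.rev d)
  | opp (f : F) (i : Fin 4) : StripAdj (G.bdry f i) (G.bdry f (i + 2))

/-- The characteristics (strips), each one given by the class of the edges that it crosses: the
equivalence relation is generated by passing to the opposite edge of a face. -/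
def Characteristic : Type u₂ := Quot G.StripAdj

/-- The characteristic that crosses a given edge. -/
def char (d : D) : G.Characteristic := Quot.mk _ d

open Classical in
/-- The number of intersections (without signs) of the characteristic `C` with the path `p`. -/
noncomputable def ind (C : G.Characteristic) (p : List D) : ℕ := (p.map G.char).count C

/-- The field `v` satisfies the dKdV equation `(v₁₂ - v) (v₁ - v₂) = α₁ - α₂` on every face, where
`v, v₁, v₁₂, v₂` are the values at the consecutive corners, `α₁` is the parameter of the edge
`(v, v₁)` and `α₂` is that of `(v₁, v₁₂)`, which is also that of `(v, v₂)`. -/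
def IsSolution (α : G.Characteristic → ℂ) (v : V → ℂ) : Prop :=
  ∀ f : F,
    (v (G.src (G.bdry f 2)) - v (G.src (G.bdry f 0))) *
        (v (G.src (G.bdry f 1)) - v (G.src (G.bdry f 3))) =
      α (G.char (G.bdry f 0)) - α (G.char (G.bdry f 1))

/-- The Lax matrix `L_{j,i}` of the directed edge `d` from `i` to `j`. -/
def lax (α : G.Characteristic → ℂ) (v : V → ℂ) (z : ℂ) (d : D) : Matrix (Fin 2) (Fin 2) ℂ :=
  !![-v (G.src d), v (G.src d) * v (G.tgt d) + α (G.char d) - z;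
     -1, v (G.tgt d)]

/-- The product of the Lax matrices along a path, ordered from right to left: along
`i₀, i₁, …, iₙ` it is `L_{iₙ,iₙ₋₁} ⋯ L_{i₂,i₁} L_{i₁,i₀}`. -/
def laxProd (α : G.Characteristic → ℂ) (v : V → ℂ) (z : ℂ) : List D → Matrix (Fin 2) (Fin 2) ℂ
  | [] => 1
  | d :: p => laxProd α v z p * G.lax α v z d

end QuadGraph

/-! For part 1, inserting a backtrack or a face boundary into a path multiplies the Lax product by
one factor `z - α_C` per pair of new crossings. The backtrack case is `edgeLax_swap_mul`; the face
case is the zero curvature identity `edgeLax_face`. Contractibility then reduces a closed path to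
the empty one. Undoing insertions means cancelling these factors, so the argument runs over `ℂ[X]`
with `z = X`, where none of them vanishes, and is evaluated at the end.

For part 2, applying this to `P₁` followed by the reverse of `P₂` shows that the two products agree
(`pathLax_eq_of_ind_eq`). A product determines its factors along a given path. At the parameter of
the first edge its Lax matrix has rank one, and its kernel reveals the next field value, provided
that the whole product is nonzero there. The edge is then cancelled and the argument repeated
(`eq_on_support_of_pathLax_eq`).

It remains to ensure this nonvanishing at every parameter of `P₁`. Distinct parameters give it
directly (`pathLax_ne_zero_of_nodup`). Otherwise it is an open condition, given by a polynomial `g`,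
and one solution must satisfy it. That solution is a discrete linear one, with increments `±√(α +
c)` whose signs come from orienting all strips consistently with `P₁` (`exists_orientation`,
`exists_solution_pathLax_ne_zero`). -/

namespace QuadGraph

/-! ### Identities for a single Lax matrix and a single face. -/

section LaxMatrix

variable {R S : Type*} [CommRing R] [CommRing S]

/-- The Lax matrix of an edge with field values `a`, `b` at its ends and parameter `c`. -/
def edgeLax (a b c z : R) : Matrix (Fin 2) (Fin 2) R :=
  !![-a, a * b + c - z; -1, b]

theorem edgeLax_map (φ : R →+* S) (a b c z : R) :
    (edgeLax a b c z).map φ = edgeLax (φ a) (φ b) (φ c) (φ z) := by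
  ext i j
  fin_cases i <;> fin_cases j <;> simp [edgeLax]

theorem edgeLax_swap_mul (a b c z : R) :
    edgeLax b a c z * edgeLax a b c z = (z - c) • (1 : Matrix (Fin 2) (Fin 2) R) := by
  ext i j
  fin_cases i <;> fin_cases j <;>
    simp [edgeLax, Matrix.mul_apply, Fin.sum_univ_two] <;> ring

/-- Zero curvature: under the dKdV equation the Lax product around a face is scalar. -/
theorem edgeLax_face {v x y w c e : R} (z : R) (h : (y - v) * (x - w) = c - e) :
    edgeLax w v e z * (edgeLax y w c z * (edgeLax x y e z * edgeLax v x c z)) =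
      ((z - c) * (z - e)) • (1 : Matrix (Fin 2) (Fin 2) R) := by
  -- The two ways from `v` to the opposite corner `y` give the same product; the remaining two edges
  -- then undo it.
  have key : edgeLax x y e z * edgeLax v x c z = edgeLax w y c z * edgeLax v w e z := by
    ext i j
    fin_cases i <;> fin_cases j <;>
      simp [edgeLax, Matrix.mul_apply, Fin.sum_univ_two]
    · linear_combination -h
    · linear_combination (x + w) * h
    · linear_combination h
  rw [key, ← mul_assoc (edgeLax y w c z), edgeLax_swap_mul, smul_mul_assoc, one_mul,
    mul_smul_comm, edgeLax_swap_mul, smul_smul]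

end LaxMatrix

variable {V : Type*} {D : Type*} {F : Type*} (G : QuadGraph V D F)

/-! ### Lax products under homotopy of paths. -/

section PathLax

variable {R S : Type*} [CommRing R] [CommRing S]

/-- The product of the Lax matrices along a path, over any commutative ring. -/
def pathLax (β : G.Characteristic → R) (u : V → R) (z : R) : List D → Matrix (Fin 2) (Fin 2) R
  | [] => 1
  | d :: p => pathLax β u z p * edgeLax (u (G.src d)) (u (G.tgt d)) (β (G.char d)) z

theorem laxProd_eq_pathLax (α : G.Characteristic → ℂ) (v : V → ℂ) (z : ℂ) (p : List D) :
    G.laxProd α v z p = G.pathLax α v z p := by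
  induction p with
  | nil => rfl
  | cons d p ih => simp only [laxProd, pathLax, ih]; rfl

variable (β : G.Characteristic → R) (u : V → R) (z : R)

theorem pathLax_map (φ : R →+* S) (p : List D) :
    (G.pathLax β u z p).map φ =
      G.pathLax (fun C => φ (β C)) (fun x => φ (u x)) (φ z) p := by
  induction p with
  | nil => exact Matrix.map_one _ (map_zero φ) (map_one φ)
  | cons d p ih => simp only [pathLax, Matrix.map_mul, ih, edgeLax_map]

theorem pathLax_append (p q : List D) :
    G.pathLax β u z (p ++ q) = G.pathLax β u z q * G.pathLax β u z p := by
  induction p with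
  | nil => simp [pathLax]
  | cons d p ih => simp only [List.cons_append, pathLax, ih, mul_assoc]

variable {G} in
theorem pathLax_congr {u w : V → R} {a b : V} {p : List D} (hp : G.IsPath a p b)
    (h : ∀ x ∈ G.support a p, u x = w x) : G.pathLax β u z p = G.pathLax β w z p := by
  induction p generalizing a with
  | nil => rfl
  | cons d p ih =>
    obtain ⟨hd, hp⟩ := hp
    have h1 : u (G.src d) = w (G.src d) := h _ (by simp [support, hd])
    have h2 : u (G.tgt d) = w (G.tgt d) := h _ (by simp [support])
    simp only [pathLax, h1, h2]
    rw [ih hp fun x hx => h x (by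
      simp only [support, List.map_cons, List.mem_cons] at hx ⊢; tauto)]

theorem det_edgeLax (a b c z : R) : (edgeLax a b c z).det = c - z := by
  simp only [edgeLax, Matrix.det_fin_two_of]
  ring

theorem char_rev (d : D) : G.char (G.rev d) = G.char d :=
  (Quot.sound (StripAdj.rev d)).symm

theorem char_opp (f : F) (i : Fin 4) : G.char (G.bdry f (i + 2)) = G.char (G.bdry f i) :=
  (Quot.sound (StripAdj.opp f i)).symm

theorem tgt_rev (d : D) : G.tgt (G.rev d) = G.src d := by simp [tgt, G.rev_rev]

theorem src_rev (d : D) : G.src (G.rev d) = G.tgt d := rfl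

theorem tgt_bdry (f : F) (i : Fin 4) : G.tgt (G.bdry f i) = G.src (G.bdry f (i + 1)) :=
  G.bdry_chain f i

theorem ind_append (C : G.Characteristic) (p q : List D) :
    G.ind C (p ++ q) = G.ind C p + G.ind C q := by
  simp only [ind, List.map_append, List.count_append]

theorem finite_ind_ne_zero (p : List D) : {C | G.ind C p ≠ 0}.Finite := by
  classical
  refine (List.finite_toSet (p.map G.char)).subset fun C hC => ?_
  by_contra h
  refine hC ?_
  rw [ind]
  exact List.count_eq_zero_of_not_mem h

theorem finite_ind_half_ne_zero (p : List D) : {C | G.ind C p / 2 ≠ 0}.Finite :=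
  (G.finite_ind_ne_zero p).subset fun C hC h0 => hC (by simp [h0])

/-- The product of the factors `z - β C` with multiplicities `n C`. -/
noncomputable def charProd (n : G.Characteristic → ℕ) : R := ∏ᶠ C, (z - β C) ^ n C

variable {G β z}

theorem finite_mulSupport_pow {n : G.Characteristic → ℕ} (hn : {C | n C ≠ 0}.Finite) :
    (Function.mulSupport fun C => (z - β C) ^ n C).Finite :=
  hn.subset fun C hC h0 => hC (by simp [h0])

theorem charProd_add {n m : G.Characteristic → ℕ} (hn : {C | n C ≠ 0}.Finite)
    (hm : {C | m C ≠ 0}.Finite) :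
    G.charProd β z (fun C => n C + m C) = G.charProd β z n * G.charProd β z m := by
  simp only [charProd, pow_add]
  exact finprod_mul_distrib (finite_mulSupport_pow hn) (finite_mulSupport_pow hm)

open Classical in
theorem charProd_ite (C₀ : G.Characteristic) :
    G.charProd β z (fun C => if C₀ = C then 1 else 0) = z - β C₀ := by
  rw [charProd, finprod_eq_single _ C₀]
  · simp
  · intro C hC
    simp [Ne.symm hC]

open Classical in
theorem charProd_half_add {n : G.Characteristic → ℕ} (hn : {C | n C ≠ 0}.Finite)
    (C₀ : G.Characteristic) :
    G.charProd β z (fun C => (n C + 2 * if C₀ = C then 1 else 0) / 2) =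
      (z - β C₀) * G.charProd β z (fun C => n C / 2) := by
  rw [← charProd_ite (β := β) (z := z) C₀, mul_comm,
    ← charProd_add (hn.subset fun C hC h0 => hC (by simp [h0]))]
  · congr 1
    ext C
    rw [Nat.add_mul_div_left _ _ two_pos]
  · exact (Set.finite_singleton C₀).subset fun C hC => by
      by_contra hne
      exact hC (if_neg (Ne.symm hne))

theorem charProd_ne_zero [IsDomain R] (hz : ∀ C, z - β C ≠ 0) (n : G.Characteristic → ℕ) :
    G.charProd β z n ≠ 0 :=
  finprod_induction (· ≠ 0) one_ne_zero (fun _ _ => mul_ne_zero) fun C => pow_ne_zero _ (hz C)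

/-- The dKdV equation on every face, over any commutative ring. -/
def IsDKdV (G : QuadGraph V D F) (β : G.Characteristic → R) (u : V → R) : Prop :=
  ∀ (f : F) (i : Fin 4),
    (u (G.src (G.bdry f (i + 2))) - u (G.src (G.bdry f i))) *
        (u (G.src (G.bdry f (i + 1))) - u (G.src (G.bdry f (i + 3)))) =
      β (G.char (G.bdry f i)) - β (G.char (G.bdry f (i + 1)))

theorem IsSolution.isDKdV {α : G.Characteristic → ℂ} {v : V → ℂ} (hv : G.IsSolution α v) :
    G.IsDKdV α v := by
  intro f i
  have h := hv f
  have h2 : G.char (G.bdry f 2) = G.char (G.bdry f 0) := G.char_opp f 0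
  have h3 : G.char (G.bdry f 3) = G.char (G.bdry f 1) := G.char_opp f 1
  fin_cases i
  · simpa using h
  · change (v (G.src (G.bdry f 3)) - v (G.src (G.bdry f 1))) *
      (v (G.src (G.bdry f 2)) - v (G.src (G.bdry f 0))) =
      α (G.char (G.bdry f 1)) - α (G.char (G.bdry f 2))
    rw [h2]
    linear_combination -h
  · change (v (G.src (G.bdry f 0)) - v (G.src (G.bdry f 2))) *
      (v (G.src (G.bdry f 3)) - v (G.src (G.bdry f 1))) =
      α (G.char (G.bdry f 2)) - α (G.char (G.bdry f 3))
    rw [h2, h3]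
    linear_combination h
  · change (v (G.src (G.bdry f 1)) - v (G.src (G.bdry f 3))) *
      (v (G.src (G.bdry f 0)) - v (G.src (G.bdry f 2))) =
      α (G.char (G.bdry f 3)) - α (G.char (G.bdry f 0))
    rw [h3]
    linear_combination -h

theorem IsDKdV.map {u : V → R} (hu : G.IsDKdV β u) (φ : R →+* S) :
    G.IsDKdV (fun C => φ (β C)) fun x => φ (u x) := by
  intro f i
  simp only [← map_sub, ← map_mul, hu f i]

theorem pathLax_backtrack (u : V → R) (p q : List D) (d : D) :
    G.pathLax β u z (p ++ d :: G.rev d :: q) =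
      (z - β (G.char d)) • G.pathLax β u z (p ++ q) := by
  simp only [pathLax_append, pathLax, char_rev, tgt_rev, src_rev, mul_assoc]
  rw [← mul_assoc (edgeLax _ _ _ _) (edgeLax _ _ _ _), edgeLax_swap_mul]
  simp

theorem pathLax_face {u : V → R} (hu : G.IsDKdV β u) (p q : List D) (f : F) (i : Fin 4) :
    G.pathLax β u z
        (p ++ G.bdry f i :: G.bdry f (i + 1) :: G.bdry f (i + 2) :: G.bdry f (i + 3) :: q) =
      ((z - β (G.char (G.bdry f i))) * (z - β (G.char (G.bdry f (i + 1))))) •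
        G.pathLax β u z (p ++ q) := by
  have e2 : i + 1 + 1 = i + 2 := by rw [add_assoc]; rfl
  have e3 : i + 2 + 1 = i + 3 := by rw [add_assoc]; rfl
  have e4 : i + 3 + 1 = i := by rw [add_assoc]; exact add_zero i
  have e5 : i + 3 = i + 1 + 2 := by rw [add_assoc]; rfl
  have c3 : G.char (G.bdry f (i + 3)) = G.char (G.bdry f (i + 1)) := by rw [e5, char_opp]
  have key := congrArg (fun M => G.pathLax β u z q * (M * G.pathLax β u z p))
    (edgeLax_face z (hu f i))
  simp only [smul_mul_assoc, one_mul, mul_smul_comm] at key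
  simp only [pathLax_append, pathLax, tgt_bdry, char_opp, c3, e2, e3, e4]
  simpa only [mul_assoc] using key

open Classical in
theorem ind_backtrack (C : G.Characteristic) (p q : List D) (d : D) :
    G.ind C (p ++ d :: G.rev d :: q) =
      G.ind C (p ++ q) + 2 * if G.char d = C then 1 else 0 := by
  simp only [ind, List.map_append, List.map_cons, List.count_append, List.count_cons, char_rev,
    beq_iff_eq]
  split_ifs <;> omega

open Classical in
theorem ind_face (C : G.Characteristic) (p q : List D) (f : F) (i : Fin 4) :
    G.ind C (p ++ G.bdry f i :: G.bdry f (i + 1) :: G.bdry f (i + 2) :: G.bdry f (i + 3) :: q) =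
      G.ind C (p ++ q) + 2 * (if G.char (G.bdry f i) = C then 1 else 0) +
        2 * if G.char (G.bdry f (i + 1)) = C then 1 else 0 := by
  have e5 : i + 3 = i + 1 + 2 := by rw [add_assoc]; rfl
  simp only [ind, List.map_append, List.map_cons, List.count_append, List.count_cons, e5,
    char_opp, beq_iff_eq]
  split_ifs <;> omega

theorem step_ind_even {a : V} {p q : List D} (h : G.Step a p q) (C : G.Characteristic) :
    Even (G.ind C p) ↔ Even (G.ind C q) := by
  classical
  induction h with
  | backtrack p q d _ =>
    rw [ind_backtrack, Nat.even_add]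
    simp only [even_two_mul, iff_true]
  | face p q f i _ =>
    rw [ind_face, Nat.even_add, Nat.even_add]
    simp only [even_two_mul, iff_true]

/-- The invariant is the Lax product divided by `∏ (z - β C) ^ (ind / 2)`. It is cross-multiplied to
avoid denominators. Rounding in `ind / 2` is harmless, since a step changes each `ind` by an even
number. -/
theorem pathLax_step {u : V → R} (hu : G.IsDKdV β u) {a : V} {p q : List D} (h : G.Step a p q) :
    G.charProd β z (fun C => G.ind C q / 2) • G.pathLax β u z p =
      G.charProd β z (fun C => G.ind C p / 2) • G.pathLax β u z q := by
  classical
  induction h with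
  | backtrack p q d _ =>
    simp only [ind_backtrack]
    rw [pathLax_backtrack, charProd_half_add (G.finite_ind_ne_zero _), smul_smul, mul_comm]
  | face p q f i _ =>
    have hfin : {C | G.ind C (p ++ q) +
        2 * (if G.char (G.bdry f i) = C then 1 else 0) ≠ 0}.Finite := by
      simp only [← ind_backtrack]
      exact G.finite_ind_ne_zero _
    simp only [ind_face]
    rw [pathLax_face hu, smul_smul, charProd_half_add hfin,
      charProd_half_add (G.finite_ind_ne_zero _)]
    congr 1
    ring

theorem ind_even_of_eqvGen {a : V} {p q : List D} (h : Relation.EqvGen (G.Step a) p q)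
    (C : G.Characteristic) : Even (G.ind C p) ↔ Even (G.ind C q) := by
  induction h with
  | rel _ _ h => exact step_ind_even h C
  | refl => rfl
  | symm _ _ _ ih => exact ih.symm
  | trans _ _ _ _ _ ih₁ ih₂ => exact ih₁.trans ih₂

/-- Transitivity must cancel the scalar of the intermediate path, hence the domain and `hz`. -/
theorem pathLax_eqvGen [IsDomain R] (hz : ∀ C, z - β C ≠ 0) {u : V → R} (hu : G.IsDKdV β u)
    {a : V} {p q : List D} (h : Relation.EqvGen (G.Step a) p q) :
    G.charProd β z (fun C => G.ind C q / 2) • G.pathLax β u z p =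
      G.charProd β z (fun C => G.ind C p / 2) • G.pathLax β u z q := by
  induction h with
  | rel _ _ h => exact pathLax_step hu h
  | refl => rfl
  | symm _ _ _ ih => exact ih.symm
  | trans p q r _ _ ih₁ ih₂ =>
    refine smul_right_injective _ (charProd_ne_zero hz fun C => G.ind C q / 2) ?_
    simp only
    rw [smul_comm, ih₁, smul_comm, ih₂, smul_comm]

theorem pathLax_closed [IsDomain R] (hG : G.SimplyConnected) (hz : ∀ C, z - β C ≠ 0) {u : V → R}
    (hu : G.IsDKdV β u) {a : V} {p : List D} (hp : G.IsPath a p a) :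
    G.pathLax β u z p =
      G.charProd β z (fun C => G.ind C p / 2) • (1 : Matrix (Fin 2) (Fin 2) R) := by
  have h := pathLax_eqvGen hz hu (hG.2 a p hp)
  have h0 : G.charProd β z (fun C => G.ind C [] / 2) = 1 := by simp [charProd, ind]
  rwa [h0, one_smul, pathLax] at h

/-- The path traversed backwards. -/
def revPath (G : QuadGraph V D F) (p : List D) : List D := (p.map G.rev).reverse

theorem isPath_append {a b : V} {p q : List D} :
    G.IsPath a (p ++ q) b ↔ ∃ c, G.IsPath a p c ∧ G.IsPath c q b := by
  induction p generalizing a with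
  | nil => simp [IsPath]
  | cons d p ih => simp [IsPath, ih, and_assoc]

theorem isPath_revPath {a b : V} {p : List D} (hp : G.IsPath a p b) :
    G.IsPath b (G.revPath p) a := by
  induction p generalizing a with
  | nil => exact hp.symm
  | cons d p ih =>
    rw [revPath, List.map_cons, List.reverse_cons, isPath_append]
    exact ⟨_, ih hp.2, rfl, by rw [tgt_rev]; exact hp.1⟩

theorem ind_revPath (C : G.Characteristic) (p : List D) : G.ind C (G.revPath p) = G.ind C p := by
  simp only [ind, revPath, List.map_reverse, List.map_map, List.count_reverse]
  congr 1
  exact List.map_congr_left fun d _ => G.char_rev d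

/-- The Lax products along two paths with the same ends and the same crossing numbers agree. -/
theorem pathLax_eq_of_ind_eq [IsDomain R] (hG : G.SimplyConnected) (hz : ∀ C, z - β C ≠ 0)
    {u : V → R} (hu : G.IsDKdV β u) {a b : V} {p q : List D} (hp : G.IsPath a p b)
    (hq : G.IsPath a q b) (h : ∀ C, G.ind C p = G.ind C q) :
    G.pathLax β u z p = G.pathLax β u z q := by
  have half : ∀ r s : List D, (∀ C, G.ind C r = G.ind C p) → (∀ C, G.ind C s = G.ind C p) →
      (fun C => G.ind C (r ++ s) / 2) = fun C => G.ind C p := by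
    intro r s hr hs
    ext C
    rw [ind_append, hr, hs]
    omega
  have hrev : ∀ C, G.ind C (G.revPath q) = G.ind C p := fun C => by rw [ind_revPath, h]
  -- With `q'` the reverse of `q`, both `L(q') L(p)` and `L(q) L(q')` equal the same scalar `K`.
  -- Hence `K L(p) = L(q) L(q') L(p) = K L(q)`, and `K` cancels.
  have h₁ := pathLax_closed hG hz hu (isPath_append.2 ⟨b, hp, isPath_revPath hq⟩)
  have h₂ := pathLax_closed hG hz hu (isPath_append.2 ⟨a, isPath_revPath hq, hq⟩)
  rw [half _ _ (fun _ => rfl) hrev, pathLax_append] at h₁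
  rw [half _ _ hrev fun C => (h C).symm, pathLax_append] at h₂
  refine smul_right_injective _ (charProd_ne_zero hz fun C => G.ind C p) ?_
  change _ • _ = _ • _
  calc _ = (G.charProd β z (fun C => G.ind C p) • (1 : Matrix (Fin 2) (Fin 2) R)) * G.pathLax β u z p := by
        rw [smul_mul_assoc, one_mul]
    _ = G.pathLax β u z q * (G.pathLax β u z (G.revPath q) * G.pathLax β u z p) := by
        rw [← h₂, mul_assoc]
    _ = _ := by rw [h₁, mul_smul_comm, mul_one]

end PathLax

/-! ### Uniqueness of the factorization along a given path. -/

section Refactorization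

open Polynomial

variable {G}

/-- A nonzero `2 × 2` matrix kills at most one vector of the form `(x, 1)`. -/
theorem eq_of_mul_edgeLax {M N : Matrix (Fin 2) (Fin 2) ℂ} {a b b' c : ℂ}
    (h : M * edgeLax a b c c = N * edgeLax a b' c c) (h0 : M * edgeLax a b c c ≠ 0) : b' = b := by
  by_contra hne
  apply h0
  -- At spectral value `c` the Lax matrix is the column `(a, 1)` times the row `(-1, y)`, so it
  -- kills `(y, 1)`.
  have kill : ∀ (K : Matrix (Fin 2) (Fin 2) ℂ) (y : ℂ) (i : Fin 2),
      (K * edgeLax a y c c) i 0 * y + (K * edgeLax a y c c) i 1 = 0 := by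
    intro K y i
    simp only [edgeLax, Matrix.mul_apply, Fin.sum_univ_two, Matrix.of_apply, Matrix.cons_val_zero,
      Matrix.cons_val_one, Matrix.cons_val', Matrix.cons_val_fin_one]
    ring
  have h1 := kill M b
  have h2 := kill N b'
  rw [← h] at h2
  have h3 : ∀ i, (M * edgeLax a b c c) i 0 = 0 := fun i => by
    have : (M * edgeLax a b c c) i 0 * (b' - b) = 0 := by linear_combination h2 i - h1 i
    exact (mul_eq_zero.1 this).resolve_right (sub_ne_zero.2 hne)
  ext i j
  fin_cases j
  · exact h3 i
  · have := h1 i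
    rw [h3 i, zero_mul, zero_add] at this
    exact this

theorem mul_edgeLax_right_cancel {R : Type*} [CommRing R] [IsDomain R]
    {M N : Matrix (Fin 2) (Fin 2) R} {a b c z : R}
    (hz : z - c ≠ 0) (h : M * edgeLax a b c z = N * edgeLax a b c z) : M = N := by
  have h' := congrArg (· * edgeLax b a c z) h
  simp only [mul_assoc, edgeLax_swap_mul, mul_smul_comm, mul_one] at h'
  exact smul_right_injective _ hz h'

/-- The Lax product with polynomial entries in the spectral parameter. -/
noncomputable def polyLax (G : QuadGraph V D F) (α : G.Characteristic → ℂ) (v : V → ℂ)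
    (p : List D) : Matrix (Fin 2) (Fin 2) ℂ[X] :=
  G.pathLax (fun C' => C (α C')) (fun x => C (v x)) X p

theorem polyLax_map_eval (α : G.Characteristic → ℂ) (v : V → ℂ) (z : ℂ) (p : List D) :
    (polyLax G α v p).map (evalRingHom z) = G.pathLax α v z p := by
  rw [polyLax, pathLax_map]
  simp

theorem polyLax_eq_iff {α : G.Characteristic → ℂ} {v w : V → ℂ} {p q : List D} :
    polyLax G α v p = polyLax G α w q ↔ ∀ z, G.pathLax α v z p = G.pathLax α w z q := by
  constructor
  · intro h z
    rw [← polyLax_map_eval, h, polyLax_map_eval]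
  · intro h
    ext1 i j
    refine Polynomial.funext fun z => ?_
    have := congrFun (congrFun (h z) i) j
    rwa [← polyLax_map_eval, ← polyLax_map_eval] at this

theorem X_sub_C_param_ne_zero (α : G.Characteristic → ℂ) (C' : G.Characteristic) :
    (X : ℂ[X]) - C (α C') ≠ 0 := X_sub_C_ne_zero _

/-- The factorization of a Lax product along a given path is unique, provided that the product
vanishes at no parameter of the path. -/
theorem eq_on_support_of_pathLax_eq {α : G.Characteristic → ℂ} {v w : V → ℂ} {a b : V}
    {p : List D} (hp : G.IsPath a p b) (ha : w a = v a)
    (h : ∀ z, G.pathLax α w z p = G.pathLax α v z p)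
    (h0 : ∀ d ∈ p, G.pathLax α v (α (G.char d)) p ≠ 0) :
    ∀ x ∈ G.support a p, w x = v x := by
  induction p generalizing a with
  | nil =>
    intro x hx
    rw [support, List.map_nil, List.mem_singleton] at hx
    rw [hx, ha]
  | cons d p ih =>
    obtain ⟨rfl, hp⟩ := hp
    have hd : w (G.tgt d) = v (G.tgt d) := by
      have h1 := (h (α (G.char d))).symm
      have h2 := h0 d List.mem_cons_self
      simp only [pathLax, ha] at h1 h2
      exact eq_of_mul_edgeLax h1 h2
    have hrest : ∀ z, G.pathLax α w z p = G.pathLax α v z p := by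
      -- The first factor is singular at its own parameter, so it is cancelled over `ℂ[X]` rather
      -- than pointwise.
      refine polyLax_eq_iff.1 ?_
      have h1 := polyLax_eq_iff.2 h
      simp only [polyLax, pathLax, ha, hd] at h1
      exact mul_edgeLax_right_cancel (X_sub_C_ne_zero _) h1
    have := ih hp hd hrest fun e he h3 => by
      refine h0 e (List.mem_cons_of_mem _ he) ?_
      rw [pathLax, h3, zero_mul]
    intro x hx
    rcases List.mem_cons.1 hx with rfl | hx
    · exact ha
    · exact this x hx

theorem det_pathLax {R : Type*} [CommRing R] (β : G.Characteristic → R) (u : V → R) (z : R)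
    (p : List D) :
    (G.pathLax β u z p).det = (p.map fun d => β (G.char d) - z).prod := by
  induction p with
  | nil => simp [pathLax]
  | cons d p ih => simp [pathLax, ih, det_edgeLax, mul_comm]

/-- At the parameter of `d` every other factor is invertible by its determinant, and the factor of
`d` has an entry `-1`. -/
theorem pathLax_ne_zero_of_nodup {α : G.Characteristic → ℂ} {p : List D}
    (hp : (p.map fun d => α (G.char d)).Nodup) (v : V → ℂ) {d : D} (hd : d ∈ p) :
    G.pathLax α v (α (G.char d)) p ≠ 0 := by
  obtain ⟨s, t, rfl⟩ := List.append_of_mem hd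
  rw [List.map_append, List.map_cons, List.nodup_middle] at hp
  have hunit : ∀ q : List D, (∀ e ∈ q, e ∈ s ++ t) →
      IsUnit (G.pathLax α v (α (G.char d)) q) := by
    intro q hq
    rw [Matrix.isUnit_iff_isUnit_det, det_pathLax, isUnit_iff_ne_zero]
    refine List.prod_ne_zero fun h0 => ?_
    obtain ⟨e, he, h⟩ := List.mem_map.1 h0
    refine (List.nodup_cons.1 hp).1 ?_
    rw [← List.map_append]
    exact List.mem_map.2 ⟨e, hq e he, sub_eq_zero.1 h⟩
  intro h0
  rw [pathLax_append, pathLax, (hunit s fun e he => by simp [he]).mul_left_eq_zero,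
    (hunit t fun e he => by simp [he]).mul_right_eq_zero] at h0
  have := congrFun (congrFun h0 1) 0
  simp [edgeLax] at this

end Refactorization

/-! ### Consistent orientation of the strips. -/

section Orientation

/-- `e` is the edge opposite to `d` in the face on the left of `d`, with the parallel direction. -/
def Across (d e : D) : Prop := ∃ f i, d = G.bdry f i ∧ e = G.rev (G.bdry f (i + 2))

/-- `d` and `e` cross one strip in the same direction. -/
def Codirected (d e : D) : Prop :=
  Relation.ReflTransGen G.Across d e ∨ Relation.ReflTransGen G.Across e d

variable {G}

theorem Across.rev {d e : D} (h : G.Across d e) : G.Across (G.rev e) (G.rev d) := by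
  obtain ⟨f, i, rfl, rfl⟩ := h
  refine ⟨f, i + 2, G.rev_rev _, ?_⟩
  rw [add_assoc]
  simp

theorem across_rightUnique : Relator.RightUnique G.Across := by
  rintro d _ _ ⟨f, i, rfl, rfl⟩ ⟨f', i', h, rfl⟩
  have := G.bdry_injective (a₁ := (f, i)) (a₂ := (f', i')) h
  simp only [Prod.mk.injEq] at this
  rw [this.1, this.2]

theorem across_swap_rightUnique : Relator.RightUnique (Function.swap G.Across) := by
  intro d e e' h h'
  have := across_rightUnique (Across.rev h) (Across.rev h')
  rw [← G.rev_rev e, this, G.rev_rev]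

theorem Codirected.symm {d e : D} (h : G.Codirected d e) : G.Codirected e d := Or.symm h

/-- `Across` is a partial injection, so two edges reachable from a common one, or reaching a common
one, are comparable. -/
theorem Codirected.trans {d e k : D} (h : G.Codirected d e) (h' : G.Codirected e k) :
    G.Codirected d k := by
  rcases h with h | h <;> rcases h' with h' | h'
  · exact Or.inl (h.trans h')
  · have := Relation.ReflTransGen.total_of_right_unique across_swap_rightUnique
      (Relation.reflTransGen_swap.2 h) (Relation.reflTransGen_swap.2 h')
    simpa only [Relation.reflTransGen_swap, Codirected, or_comm] using this
  · exact Relation.ReflTransGen.total_of_right_unique across_rightUnique h h'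
  · exact Or.inr (h'.trans h)

theorem reflTransGen_across_rev {d e : D} (h : Relation.ReflTransGen G.Across d e) :
    Relation.ReflTransGen G.Across (G.rev e) (G.rev d) := by
  induction h with
  | refl => exact .refl
  | tail _ h ih => exact .head h.rev ih

theorem Codirected.rev {d e : D} (h : G.Codirected d e) :
    G.Codirected (G.rev d) (G.rev e) :=
  h.symm.imp reflTransGen_across_rev reflTransGen_across_rev

theorem bdry_ne_opp (f : F) (i : Fin 4) : G.bdry f i ≠ G.bdry f (i + 2) := by
  intro h
  have := G.bdry_injective (a₁ := (f, i)) (a₂ := (f, i + 2)) h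
  simp only [Prod.mk.injEq, true_and] at this
  revert this
  fin_cases i <;> decide

/-- A strip cannot return to an edge with reversed direction. Reversing the last move of such a
chain shows that it mirrors the first, so removing both ends leaves a shorter chain of the same
kind. The descent stops at an edge equal to its reverse or at a face with two equal opposite sides,
both impossible. -/
theorem iterate_across_ne_rev (n : ℕ) :
    ∀ s : ℕ → D, (∀ k < n, G.Across (s k) (s (k + 1))) → s n ≠ G.rev (s 0) := by
  induction n using Nat.strong_induction_on with
  | _ n ih =>
    intro s hs h
    rcases n with _ | _ | n
    · exact G.rev_ne _ h.symm
    · obtain ⟨f, i, h0, h1⟩ := hs 0 one_pos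
      rw [h] at h1
      have := congrArg G.rev h1
      rw [G.rev_rev, G.rev_rev, h0] at this
      exact bdry_ne_opp f i this
    · refine ih n (by omega) (fun k => s (k + 1)) (fun k hk => hs (k + 1) (by omega)) ?_
      have h1 := (hs (n + 1) (by omega)).rev
      rw [h, G.rev_rev] at h1
      have := across_rightUnique h1 (hs 0 (by omega))
      rw [← this, G.rev_rev]

theorem not_reflTransGen_across_rev (d : D) :
    ¬ Relation.ReflTransGen G.Across d (G.rev d) := by
  intro h
  have : ∀ e, Relation.ReflTransGen G.Across d e →
      ∃ (n : ℕ) (s : ℕ → D), s 0 = d ∧ s n = e ∧ ∀ k < n, G.Across (s k) (s (k + 1)) := by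
    intro e he
    induction he with
    | refl => exact ⟨0, fun _ => d, rfl, rfl, by simp⟩
    | @tail x y _ hxy ih =>
      obtain ⟨n, s, h0, hn, hs⟩ := ih
      refine ⟨n + 1, fun k => if k ≤ n then s k else y, by simpa using h0, by simp, ?_⟩
      intro k hk
      rcases (Nat.lt_succ_iff.1 hk).lt_or_eq with h | rfl
      · simpa [h.le, Nat.succ_le_of_lt h] using hs k h
      · simpa [hn] using hxy
  obtain ⟨n, s, h0, hn, hs⟩ := this _ h
  exact iterate_across_ne_rev n s hs (by rw [hn, h0])

theorem not_codirected_rev (d : D) : ¬ G.Codirected d (G.rev d) := by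
  rintro (h | h)
  · exact not_reflTransGen_across_rev d h
  · refine not_reflTransGen_across_rev (G := G) (G.rev d) ?_
    rwa [G.rev_rev]

theorem codirected_bdry (f : F) (i : Fin 4) :
    G.Codirected (G.bdry f i) (G.rev (G.bdry f (i + 2))) :=
  Or.inl (.single ⟨f, i, rfl, rfl⟩)

theorem Codirected.refl (d : D) : G.Codirected d d := Or.inl .refl

theorem codirected_or_of_char_eq {d e : D} (h : G.char d = G.char e) :
    G.Codirected d e ∨ G.Codirected (G.rev d) e := by
  replace h : Relation.EqvGen G.StripAdj d e := Quot.eqvGen_exact h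
  induction h with
  | rel d e h =>
    cases h with
    | rev => exact Or.inr (.refl _)
    | opp f i =>
      right
      have h := (codirected_bdry (G := G) f i).rev
      rwa [G.rev_rev] at h
  | refl d => exact Or.inl (.refl d)
  | symm d e _ ih =>
    refine ih.imp Codirected.symm fun h => ?_
    simpa only [G.rev_rev] using h.rev.symm
  | trans d e k _ _ ih ih' =>
    rcases ih with h | h <;> rcases ih' with h' | h'
    · exact Or.inl (h.trans h')
    · exact Or.inr (h.rev.trans h')
    · exact Or.inr (h.trans h')
    · left
      have := h.rev.trans h'
      rwa [G.rev_rev] at this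

theorem nodup_map_char {p : List D} (hp : ∀ C, G.ind C p ≤ 1) : (p.map G.char).Nodup := by
  classical
  rw [List.nodup_iff_count_le_one]
  intro C
  exact hp C

theorem eq_of_char_eq_of_ind_le_one {p : List D} (hp : ∀ C, G.ind C p ≤ 1) {d e : D}
    (hd : d ∈ p) (he : e ∈ p) (h : G.char d = G.char e) : d = e :=
  List.inj_on_of_nodup_map (nodup_map_char hp) hd he h

/-- The strips can be oriented consistently, so that they cross a given path from one and the same
side. -/
theorem exists_orientation {p : List D} (hp : ∀ C, G.ind C p ≤ 1) :
    ∃ s : D → ℂ, (∀ d, s d ^ 2 = 1) ∧ (∀ d, s (G.rev d) = -s d) ∧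
      (∀ f i, s (G.bdry f (i + 2)) = -s (G.bdry f i)) ∧ ∀ d ∈ p, s d = 1 := by
  classical
  -- Each strip gets a reference direction, the one in which `p` crosses it if it does; a single
  -- crossing makes this unambiguous. The sign of `d` compares it with this reference.
  have hr : ∀ C : G.Characteristic, ∃ r, G.char r = C ∧ ∀ d ∈ p, G.char d = C → d = r := by
    intro C
    by_cases h : ∃ d ∈ p, G.char d = C
    · obtain ⟨d, hd, rfl⟩ := h
      exact ⟨d, rfl, fun e he h => eq_of_char_eq_of_ind_le_one hp he hd h⟩
    · obtain ⟨d, rfl⟩ := Quot.exists_rep C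
      exact ⟨d, rfl, fun e he h' => absurd ⟨e, he, h'⟩ h⟩
  choose r hrC hrp using hr
  have hsr : ∀ d, (if G.Codirected (G.rev d) (r (G.char (G.rev d))) then 1 else -1 : ℂ) =
      -(if G.Codirected d (r (G.char d)) then 1 else -1) := by
    intro d
    rw [char_rev]
    by_cases h : G.Codirected d (r (G.char d))
    · have h' : ¬ G.Codirected (G.rev d) (r (G.char d)) := fun h' =>
        not_codirected_rev d (h.trans h'.symm)
      rw [if_pos h, if_neg h']
    · have h' := (codirected_or_of_char_eq (hrC (G.char d)).symm).resolve_left h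
      rw [if_neg h, if_pos h', neg_neg]
  refine ⟨fun d => if G.Codirected d (r (G.char d)) then 1 else -1, fun d => ?_, hsr,
    fun f i => ?_, fun d hd => ?_⟩
  · simp only
    split_ifs <;> norm_num
  · have h := hsr (G.bdry f (i + 2))
    rw [eq_neg_iff_add_eq_zero, add_comm, ← eq_neg_iff_add_eq_zero] at h
    simp only
    rw [h, char_rev, char_opp]
    congr 1
    exact if_congr ⟨fun h => (codirected_bdry f i).trans h,
      fun h => (codirected_bdry f i).symm.trans h⟩ rfl rfl
  · simp only
    rw [← hrp _ d hd rfl, if_pos (.refl d)]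

end Orientation

/-! ### Discrete linear solutions and their wave functions. -/

section LinearSolution

variable {G}

/-- A closed discrete one-form on a simply connected quad-graph is exact. -/
theorem exists_potential (hG : G.SimplyConnected) (a : V) {θ : D → ℂ}
    (hrev : ∀ d, θ (G.rev d) = -θ d) (hopp : ∀ f i, θ (G.bdry f (i + 2)) = -θ (G.bdry f i)) :
    ∃ v : V → ℂ, ∀ d, v (G.tgt d) = v (G.src d) + θ d := by
  -- The integral of `θ` along a path is invariant under homotopy, so integrating from `a` defines
  -- the potential.
  have hstep : ∀ p q : List D, Relation.EqvGen (G.Step a) p q →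
      (p.map θ).sum = (q.map θ).sum := by
    intro p q h
    induction h with
    | rel _ _ h =>
      induction h with
      | backtrack p q d _ => simp [hrev]
      | face p q f i _ =>
        have e5 : i + 3 = i + 1 + 2 := by rw [add_assoc]; rfl
        simp only [List.map_append, List.map_cons, List.sum_append, List.sum_cons, e5, hopp]
        ring
    | refl => rfl
    | symm _ _ _ ih => exact ih.symm
    | trans _ _ _ _ _ ih₁ ih₂ => exact ih₁.trans ih₂
  have hsumrev : ∀ p : List D, ((G.revPath p).map θ).sum = -(p.map θ).sum := by
    intro p
    induction p with
    | nil => simp [revPath]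
    | cons d p ih =>
      rw [revPath, List.map_cons, List.reverse_cons, List.map_append, List.sum_append]
      rw [revPath] at ih
      rw [ih]
      simp [hrev]
  choose P hP using hG.1 a
  refine ⟨fun b => ((P b).map θ).sum, fun d => ?_⟩
  have hd : G.IsPath (G.src d) [d] (G.tgt d) := ⟨rfl, rfl⟩
  have h := hstep _ _ (hG.2 a _ (isPath_append.2
    ⟨_, isPath_append.2 ⟨_, hP (G.src d), hd⟩, isPath_revPath (hP (G.tgt d))⟩))
  simp only [List.map_append, List.sum_append, hsumrev, List.map_cons, List.map_nil,
    List.sum_cons, List.sum_nil] at h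
  linear_combination -h

/-- With increments `θ₁`, `θ₂` along the sides of a face, the left side of dKdV is `(θ₁ + θ₂) (θ₁ -
θ₂) = α₁ - α₂`. -/
theorem isSolution_of_potential {α : G.Characteristic → ℂ} {v : V → ℂ} {θ : D → ℂ} {c : ℂ}
    (hv : ∀ d, v (G.tgt d) = v (G.src d) + θ d)
    (hopp : ∀ f i, θ (G.bdry f (i + 2)) = -θ (G.bdry f i))
    (hsq : ∀ d, θ d ^ 2 = α (G.char d) + c) : G.IsSolution α v := by
  intro f
  have h0 := hv (G.bdry f 0)
  have h1 := hv (G.bdry f 1)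
  have h3 := hv (G.bdry f 3)
  rw [tgt_bdry] at h0 h1 h3
  have ho : θ (G.bdry f 3) = -θ (G.bdry f 1) := hopp f 1
  rw [ho] at h3
  have e0 : v (G.src (G.bdry f 1)) = v (G.src (G.bdry f 0)) + θ (G.bdry f 0) := h0
  have e1 : v (G.src (G.bdry f 2)) = v (G.src (G.bdry f 1)) + θ (G.bdry f 1) := h1
  have e3 : v (G.src (G.bdry f 0)) = v (G.src (G.bdry f 3)) + -θ (G.bdry f 1) := h3
  have e4 : v (G.src (G.bdry f 3)) = v (G.src (G.bdry f 0)) + θ (G.bdry f 1) := by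
    linear_combination -e3
  rw [e1, e0, e4]
  linear_combination hsq (G.bdry f 0) - hsq (G.bdry f 1)

/-- The wave function of a linear solution. -/
theorem pathLax_mulVec_of_potential {α : G.Characteristic → ℂ} {v : V → ℂ} {θ : D → ℂ} {c μ z : ℂ}
    (hv : ∀ d, v (G.tgt d) = v (G.src d) + θ d)
    (hsq : ∀ d, θ d ^ 2 = α (G.char d) + c) (hμ : μ ^ 2 = z + c) {a b : V} {p : List D}
    (hp : G.IsPath a p b) :
    (G.pathLax α v z p).mulVec ![v a - μ, 1] =
      (p.map fun d => θ d + μ).prod • ![v b - μ, 1] := by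
  induction p generalizing a with
  | nil =>
    obtain rfl : a = b := hp
    simp [pathLax]
  | cons d p ih =>
    obtain ⟨rfl, hp⟩ := hp
    have h : (edgeLax (v (G.src d)) (v (G.tgt d)) (α (G.char d)) z).mulVec
        ![v (G.src d) - μ, 1] = (θ d + μ) • ![v (G.tgt d) - μ, 1] := by
      ext i
      fin_cases i
      · simp [edgeLax, Matrix.mulVec, dotProduct, Fin.sum_univ_two, hv d]
        linear_combination hμ - hsq d
      · simp [edgeLax, Matrix.mulVec, dotProduct, Fin.sum_univ_two, hv d]
        ring
    rw [pathLax, ← Matrix.mulVec_mulVec, h, Matrix.mulVec_smul, ih hp, smul_smul, List.map_cons,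
      List.prod_cons]

/-- On a simply connected quad-graph there is a solution whose Lax product along a given path that
crosses each strip at most once vanishes at no parameter of the path. -/
theorem exists_solution_pathLax_ne_zero (hG : G.SimplyConnected) (α : G.Characteristic → ℂ)
    {a b : V} {p : List D} (hp : G.IsPath a p b) (hind : ∀ C, G.ind C p ≤ 1) :
    ∃ v : V → ℂ, G.IsSolution α v ∧ ∀ d ∈ p, G.pathLax α v (α (G.char d)) p ≠ 0 := by
  obtain ⟨s, hs1, hsrev, hsopp, hsp⟩ := exists_orientation hind
  -- The shift `c` keeps all increments along `p` nonzero.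
  obtain ⟨c, hc⟩ : ∃ c : ℂ, ∀ d ∈ p, α (G.char d) + c ≠ 0 := by
    obtain ⟨c, hc⟩ := (List.finite_toSet (p.map fun d => -α (G.char d))).exists_notMem
    refine ⟨c, fun d hd h => hc (List.mem_map.2 ⟨d, hd, ?_⟩)⟩
    linear_combination -h
  have hroot : ∀ x : ℂ, ∃ y, y ^ 2 = x := fun x => IsAlgClosed.exists_pow_nat_eq x two_pos
  choose ρ hρ using hroot
  have hθsq : ∀ d, (s d * ρ (α (G.char d) + c)) ^ 2 = α (G.char d) + c := fun d => by
    rw [mul_pow, hs1, hρ, one_mul]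
  have hθopp : ∀ f i, s (G.bdry f (i + 2)) * ρ (α (G.char (G.bdry f (i + 2))) + c) =
      -(s (G.bdry f i) * ρ (α (G.char (G.bdry f i)) + c)) := fun f i => by
    rw [hsopp, char_opp, neg_mul]
  obtain ⟨v, hv⟩ := exists_potential (θ := fun d => s d * ρ (α (G.char d) + c)) hG a
    (fun d => by rw [hsrev, char_rev, neg_mul]) hθopp
  refine ⟨v, isSolution_of_potential hv hθopp hθsq, fun d hd h0 => ?_⟩
  -- If the product vanished at the parameter of `d`, so would `∏ (ρ_e + ρ_d)` over the edges `e` of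
  -- `p`, all of sign `+1`. Then `ρ_e = -ρ_d` for some `e`; squaring gives equal parameters, hence
  -- the same chosen root, so `ρ_d = 0`, against the choice of `c`.
  have h := pathLax_mulVec_of_potential hv hθsq (hρ (α (G.char d) + c)) hp
  rw [h0, Matrix.zero_mulVec] at h
  have h1 := congrFun h 1
  simp only [Pi.zero_apply, Pi.smul_apply, Matrix.cons_val_one, Matrix.cons_val_fin_one,
    smul_eq_mul, mul_one] at h1
  obtain ⟨e, he, h2⟩ := List.mem_map.1 (List.prod_eq_zero_iff.1 h1.symm)
  rw [hsp e he, one_mul, add_eq_zero_iff_eq_neg] at h2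
  have h3 : α (G.char e) + c = α (G.char d) + c := by
    rw [← hρ (α (G.char e) + c), h2, neg_sq, hρ]
  rw [h3] at h2
  refine hc d hd ?_
  rw [← hρ (α (G.char d) + c), self_eq_neg.1 h2]
  simp

end LinearSolution

/-! ### The genericity polynomial. -/

section Generic

variable {G}

/-- The values at the vertices of a set as independent variables. -/
noncomputable def genericField (s : List V) : V → MvPolynomial {x : V // x ∈ s} ℂ := by
  classical
  exact fun x => if h : x ∈ s then MvPolynomial.X ⟨x, h⟩ else 0

theorem eval_genericField {s : List V} (v : V → ℂ) {x : V} (hx : x ∈ s) :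
    MvPolynomial.eval (fun y : {x : V // x ∈ s} => v y.1) (genericField s x) = v x := by
  simp [genericField, hx]

/-- A polynomial in the values on a path whose nonvanishing guarantees that the Lax product along
the path vanishes at no parameter of the path. -/
theorem exists_generic_polynomial {α : G.Characteristic → ℂ} {a b : V} {p : List D}
    (hp : G.IsPath a p b) {v₀ : V → ℂ} (h₀ : ∀ d ∈ p, G.pathLax α v₀ (α (G.char d)) p ≠ 0) :
    ∃ g : MvPolynomial {x : V // x ∈ G.support a p} ℂ,
      MvPolynomial.eval (fun x => v₀ x.1) g ≠ 0 ∧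
      ∀ v : V → ℂ, MvPolynomial.eval (fun x => v x.1) g ≠ 0 →
        ∀ d ∈ p, G.pathLax α v (α (G.char d)) p ≠ 0 := by
  let M : ℂ → Matrix (Fin 2) (Fin 2) (MvPolynomial {x : V // x ∈ G.support a p} ℂ) := fun z =>
    G.pathLax (fun C => MvPolynomial.C (α C)) (genericField (G.support a p)) (MvPolynomial.C z) p
  have hM : ∀ (v : V → ℂ) (z : ℂ) (i j : Fin 2),
      MvPolynomial.eval (fun x => v x.1) (M z i j) = G.pathLax α v z p i j := by
    intro v z i j
    have h := pathLax_map G (fun C => MvPolynomial.C (α C)) (genericField (G.support a p))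
      (MvPolynomial.C z) (MvPolynomial.eval fun x => v x.1) p
    simp only [MvPolynomial.eval_C] at h
    rw [pathLax_congr α z hp (w := v) fun x hx => eval_genericField v hx] at h
    exact congrFun (congrFun h i) j
  -- For each edge of `p` an entry of the product that is nonzero at `v₀` is selected; `g` is the
  -- product of these entries with the field values as variables.
  have hentry : ∀ d, ∃ ij : Fin 2 × Fin 2, d ∈ p →
      G.pathLax α v₀ (α (G.char d)) p ij.1 ij.2 ≠ 0 := by
    intro d
    by_contra! h
    refine h₀ d (h (0, 0)).1 ?_
    ext i j
    exact (h (i, j)).2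
  choose ij hij using hentry
  have hprod : ∀ v : V → ℂ, MvPolynomial.eval (fun x => v x.1)
      (p.map fun d => M (α (G.char d)) (ij d).1 (ij d).2).prod =
      (p.map fun d => G.pathLax α v (α (G.char d)) p (ij d).1 (ij d).2).prod := by
    intro v
    rw [map_list_prod, List.map_map]
    congr 1
    exact List.map_congr_left fun d _ => hM v _ _ _
  refine ⟨(p.map fun d => M (α (G.char d)) (ij d).1 (ij d).2).prod, ?_, fun v hv d hd h0 => ?_⟩
  · rw [hprod]
    refine List.prod_ne_zero fun h => ?_
    obtain ⟨d, hd, h⟩ := List.mem_map.1 h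
    exact hij d hd h
  · rw [hprod] at hv
    refine hv (List.prod_eq_zero (List.mem_map.2 ⟨d, hd, ?_⟩))
    rw [h0]
    rfl

end Generic

/-! ### Specialization to complex solutions and the theorem. -/

variable {G}

theorem pathLax_closed_of_isSolution (hG : G.SimplyConnected) {α : G.Characteristic → ℂ} {v : V → ℂ}
    (hv : G.IsSolution α v) {a : V} {p : List D} (hp : G.IsPath a p a) (z : ℂ) :
    G.pathLax α v z p =
      (∏ᶠ C : G.Characteristic, (z - α C) ^ (G.ind C p / 2)) •
        (1 : Matrix (Fin 2) (Fin 2) ℂ) := by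
  have h := pathLax_closed hG (X_sub_C_param_ne_zero α) (hv.isDKdV.map Polynomial.C) hp
  have h' := congrArg (fun M => M.map (Polynomial.evalRingHom z)) h
  change (polyLax G α v p).map _ = _ at h'
  rw [polyLax_map_eval] at h'
  rw [h']
  have hK : Polynomial.evalRingHom z (G.charProd (fun C => Polynomial.C (α C)) Polynomial.X
      fun C => G.ind C p / 2) = ∏ᶠ C : G.Characteristic, (z - α C) ^ (G.ind C p / 2) := by
    rw [charProd]
    refine (MonoidHom.map_finprod (Polynomial.evalRingHom z : Polynomial ℂ →* ℂ)
      (finite_mulSupport_pow (G.finite_ind_half_ne_zero p))).trans ?_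
    simp
  rw [← hK]
  ext i j
  by_cases hij : i = j <;> simp [hij]

theorem pathLax_eq_of_isSolution (hG : G.SimplyConnected) {α : G.Characteristic → ℂ} {v : V → ℂ}
    (hv : G.IsSolution α v) {a b : V} {p q : List D} (hp : G.IsPath a p b) (hq : G.IsPath a q b)
    (h : ∀ C, G.ind C p = G.ind C q) (z : ℂ) :
    G.pathLax α v z p = G.pathLax α v z q :=
  polyLax_eq_iff.1 (pathLax_eq_of_ind_eq hG (X_sub_C_param_ne_zero α)
    (hv.isDKdV.map Polynomial.C) hp hq h) z

theorem exists_mem_char_eq {p q : List D} (h : ∀ C, G.ind C p = G.ind C q) {d : D} (hd : d ∈ q) :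
    ∃ e ∈ p, G.char e = G.char d := by
  classical
  have h1 : 0 < G.ind (G.char d) q := by
    rw [ind]
    exact List.count_pos_iff.2 (List.mem_map_of_mem hd)
  rw [← h, ind] at h1
  exact List.mem_map.1 (List.count_pos_iff.1 h1)

end QuadGraph

theorem theorem4 {V : Type*} {D : Type*} {F : Type*} (G : QuadGraph V D F)
    (hG : G.SimplyConnected) (α : G.Characteristic → ℂ) :
    -- the ordered product of the Lax matrices along a closed path is a scalar matrix
    (∀ v : V → ℂ, G.IsSolution α v → ∀ (a : V) (P : List D), G.IsPath a P a →
      (∀ C : G.Characteristic, Even (G.ind C P)) ∧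
      ∀ z : ℂ, G.laxProd α v z P =
        (∏ᶠ C : G.Characteristic, (z - α C) ^ (G.ind C P / 2)) •
          (1 : Matrix (Fin 2) (Fin 2) ℂ)) ∧
    -- recovery of the fields on `P₂` from the values on `P₁`; generic means that a certain
    -- nonzero polynomial in the values on `P₁` does not vanish
    (∀ (a b : V) (P₁ : List D), G.IsPath a P₁ b → (∀ C : G.Characteristic, G.ind C P₁ ≤ 1) →
      ∃ g : MvPolynomial {x : V // x ∈ G.support a P₁} ℂ,
        g ≠ 0 ∧
        (∃ v : V → ℂ, G.IsSolution α v ∧ MvPolynomial.eval (fun x => v x.1) g ≠ 0) ∧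
        ∀ v : V → ℂ, G.IsSolution α v →
          (MvPolynomial.eval (fun x => v x.1) g ≠ 0 ∨
            ∀ d ∈ P₁, ∀ e ∈ P₁, α (G.char d) = α (G.char e) → G.char d = G.char e) →
          ∀ P₂ : List D, G.IsPath a P₂ b →
            (∀ C : G.Characteristic, G.ind C P₁ = G.ind C P₂) →
            -- the values on `P₁` determine those on `P₂`
            (∀ w : V → ℂ, G.IsSolution α w → (∀ x ∈ G.support a P₁, w x = v x) →
              ∀ x ∈ G.support a P₂, w x = v x) ∧
            -- and they do so by refactorization of the product of the Lax matrices along `P₁`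
            (∀ z : ℂ, G.laxProd α v z P₂ = G.laxProd α v z P₁) ∧
            (∀ w : V → ℂ, w a = v a →
              (∀ z : ℂ, G.laxProd α w z P₂ = G.laxProd α v z P₁) →
              ∀ x ∈ G.support a P₂, w x = v x)) := by
  simp only [QuadGraph.laxProd_eq_pathLax]
  refine ⟨fun v hv a P hP => ⟨fun C => ?_, QuadGraph.pathLax_closed_of_isSolution hG hv hP⟩, ?_⟩
  · rw [QuadGraph.ind_even_of_eqvGen (hG.2 a P hP) C]
    simp [QuadGraph.ind]
  intro a b P₁ hP₁ hind
  obtain ⟨v₀, hv₀, h₀⟩ := QuadGraph.exists_solution_pathLax_ne_zero hG α hP₁ hind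
  obtain ⟨g, hg₀, hg⟩ := QuadGraph.exists_generic_polynomial hP₁ h₀
  refine ⟨g, fun h => hg₀ (by rw [h, map_zero]), ⟨v₀, hv₀, hg₀⟩, fun v hv hgen P₂ hP₂ h12 => ?_⟩
  have hne₁ : ∀ d ∈ P₁, G.pathLax α v (α (G.char d)) P₁ ≠ 0 := by
    rcases hgen with hgen | hgen
    · exact hg v hgen
    · intro d hd
      refine QuadGraph.pathLax_ne_zero_of_nodup ?_ v hd
      have hnd : (P₁.map G.char).Nodup := QuadGraph.nodup_map_char hind
      refine List.Nodup.map_on (fun d hd e he h => ?_) hnd.of_map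
      exact QuadGraph.eq_of_char_eq_of_ind_le_one hind hd he (hgen d hd e he h)
  have hfac := QuadGraph.pathLax_eq_of_isSolution hG hv hP₂ hP₁ fun C => (h12 C).symm
  -- Both paths cross the same strips and have the same product, so nonvanishing passes from `P₁` to
  -- `P₂`.
  have hne₂ : ∀ d ∈ P₂, G.pathLax α v (α (G.char d)) P₂ ≠ 0 := by
    intro d hd
    obtain ⟨e, he, hed⟩ := QuadGraph.exists_mem_char_eq h12 hd
    rw [hfac, ← hed]
    exact hne₁ e he
  have huniq : ∀ w : V → ℂ, w a = v a →
      (∀ z : ℂ, G.pathLax α w z P₂ = G.pathLax α v z P₁) →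
      ∀ x ∈ G.support a P₂, w x = v x := fun w ha hw =>
    QuadGraph.eq_on_support_of_pathLax_eq hP₂ ha (fun z => (hw z).trans (hfac z).symm) hne₂
  -- For another solution `w`, the product along `P₂` equals its own product along `P₁`, which
  -- involves only values shared with `v`.
  refine ⟨fun w hw hwv => huniq w (hwv a List.mem_cons_self) fun z => ?_, hfac, huniq⟩
  rw [QuadGraph.pathLax_eq_of_isSolution hG hw hP₂ hP₁ (fun C => (h12 C).symm) z]
  exact QuadGraph.pathLax_congr α z hP₁ hwv
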